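/- Let $L$ be a language containing the language of ordered rings, with at most countably many symbols, and let $T$ be an o-minimal $L$-theory extending the theory $\mathrm{RCF}$ of real closed ordered fields (o-minimal: in every model of $T$, each subset of the line that is definable with parameters is a finite union of points and open intervals with endpoints in the model or $\pm\infty$). For a subset $A$ of a model, $\operatorname{dcl}(A)$ denotes the set of elements $a$ such that $\{a\}$ is definable with parameters from $A$. An elementary extension $N\succeq K$ of models of $T$ has $\operatorname{dcl}$-dimension $1$ over $K$ if $N=K\langle x\rangle:=\operatorname{dcl}(K\cup\{x\})$ for some $x\in N\setminus \operatorname{dcl}(K)$. **Theorem.** Let $K\models T$ be such that $(K,<)$ has no uncountable well-ordered subset, and let $K\langle x\rangle\succ K$ be an elementary extension of $\operatorname{dcl}$-dimension $1$. Then $(K\langle x\rangle,<)$ has no uncountable well-ordered subset. In other words, $T$ has property C: for every model $K$ of $T$, if $K$ contains no uncountable well-ordered subset, then neither does any elementary extension of $K$ of $\operatorname{dcl}$-dimension $1$. -/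

import Mathlib

open FirstOrder

universe u v w

namespace OMin

open FirstOrder.Language FirstOrder.Ring

/-! ### The language of ordered rings and the theory of real closed fields -/

/-- The language of ordered rings `(+, *, -, 0, 1, ≤)`. -/
abbrev oring : FirstOrder.Language := Language.ring.sum Language.order

/-- A term of the language of rings, as a term of the language of ordered rings. -/
def ofRing {α : Type} (t : Language.ring.Term α) : oring.Term α :=
  (LHom.sumInl : FirstOrder.Language.ring →ᴸ oring).onTerm t

/-- `x ≤ y → x + z ≤ y + z`. -/
def addLeAdd : oring.Sentence :=
  ∀' ∀' ∀' ((ofRing (&0)).le (ofRing (&1)) ⟹ (ofRing (&0 + &2)).le (ofRing (&1 + &2)))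

/-- `0 ≤ x → 0 ≤ y → 0 ≤ x * y`. -/
def mulNonneg : oring.Sentence :=
  ∀' ∀' ((ofRing 0).le (ofRing (&0)) ⟹ ((ofRing 0).le (ofRing (&1)) ⟹
    (ofRing 0).le (ofRing (&0 * &1))))

/-- `0 ≤ x → ∃ y, x = y * y`. -/
def nonnegIsSquare : oring.Sentence :=
  ∀' ((ofRing 0).le (ofRing (&0)) ⟹ ∃' ((ofRing (&0)).bdEqual (ofRing (&1 * &1))))

/-- The theory `RCF` of real closed ordered fields: the axioms of ordered fields, the existence of
square roots of nonnegative elements, and the existence of roots of monic polynomials of odd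
degree. -/
def RCF : oring.Theory :=
  (LHom.sumInl : FirstOrder.Language.ring →ᴸ oring).onTheory Theory.field ∪
    oring.linearOrderTheory ∪ {addLeAdd, mulNonneg, nonnegIsSquare} ∪
    (LHom.sumInl : FirstOrder.Language.ring →ᴸ oring).onTheory
      (FirstOrder.Field.genericMonicPolyHasRoot '' {n | Odd n})

/-- `T ⊇ RCF`. Here the language `L` contains the language of ordered rings through its
distinguished symbol `≤` and the interpretation `ι` of the ring symbols. -/
def ExtendsRCF {L : FirstOrder.Language.{u, v}} [L.IsOrdered] (ι : FirstOrder.Language.ring →ᴸ L) (T : L.Theory) : Prop :=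
  ∀ φ ∈ RCF, T ⊨ᵇ (ι.sumElim L.orderLHom).onSentence φ

/-! ### o-minimality -/

/-- Points, and open intervals with endpoints in `M ∪ {-∞, +∞}`. -/
def IsPointOrInterval {M : Type w} [LinearOrder M] (I : Set M) : Prop :=
  (∃ a, I = {a}) ∨ (∃ a b, I = Set.Ioo a b) ∨ (∃ a, I = Set.Iio a) ∨ (∃ a, I = Set.Ioi a) ∨
    I = Set.univ

/-- `M` is an o-minimal `L`-structure: every subset of `M` that is definable with parameters is a
finite union of points and open intervals. -/
def IsOMinimalStructure (L : FirstOrder.Language.{u, v}) (M : Type w) [LinearOrder M] [L.Structure M] :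
    Prop :=
  ∀ S : Set M, (Set.univ : Set M).Definable₁ L S →
    ∃ F : Set (Set M), F.Finite ∧ (∀ I ∈ F, IsPointOrInterval I) ∧ S = ⋃₀ F

/-- `T` is an o-minimal theory: its models are linearly ordered by `≤`, and they are all o-minimal.
(For a countable language it does not matter, by Löwenheim-Skolem, in which universe the models are
taken.) -/
def IsOMinimalTheory {L : FirstOrder.Language.{u, v}} [L.IsOrdered] (T : L.Theory) : Prop :=
  (∀ φ ∈ L.linearOrderTheory, T ⊨ᵇ φ) ∧
    ∀ (M : Type w) [LinearOrder M] [L.Structure M] [L.OrderedStructure M] [M ⊨ T],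
      IsOMinimalStructure L M

/-! ### Definable closure and dimension -/

/-- The definable closure of `A`: the elements `a` such that `{a}` is definable over `A`. -/
def dcl (L : FirstOrder.Language.{u, v}) {M : Type w} [L.Structure M] (A : Set M) : Set M :=
  {a | A.Definable₁ L {a}}

/-- `B` is a `dcl`-basis of `M` over `A`: it is `dcl`-independent over `A` and `M = dcl(A ∪ B)`. -/
def IsDclBasis (L : FirstOrder.Language.{u, v}) {M : Type w} [L.Structure M] (A B : Set M) : Prop :=
  (∀ b ∈ B, b ∉ dcl L (A ∪ (B \ {b}))) ∧ dcl L (A ∪ B) = Set.univ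

/-- `M` has `dcl`-dimension `κ` over `A`. -/
def HasDclDimension (L : FirstOrder.Language.{u, v}) {M : Type w} [L.Structure M] (A : Set M)
    (κ : Cardinal.{w}) : Prop :=
  ∃ B : Set M, IsDclBasis L A B ∧ Cardinal.mk B = κ

/-! ### Well-ordered subsets and property C -/

/-- The linear order `M` contains an uncountable well-ordered subset. -/
def ContainsUncountableWellOrder (M : Type w) [LinearOrder M] : Prop :=
  ∃ S : Set M, S.IsWF ∧ ¬ S.Countable

/-- Property C: if a model `K` of `T` contains no uncountable well-ordered subset, then neither does
any elementary extension of `K` of `dcl`-dimension 1 over `K`. -/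
def PropertyC {L : FirstOrder.Language.{u, v}} [L.IsOrdered] (T : L.Theory) : Prop :=
  ∀ (K : Type w) [LinearOrder K] [L.Structure K] [L.OrderedStructure K] [K ⊨ T],
    ¬ ContainsUncountableWellOrder K →
    ∀ (N : Type w) [LinearOrder N] [L.Structure N] [L.OrderedStructure N] (j : K ↪ₑ[L] N),
      HasDclDimension L (Set.range j) 1 → ¬ ContainsUncountableWellOrder N

end OMin

/-! Suppose $K\langle x\rangle$ has an uncountable well-ordered subset. The language is countable,
so for uncountably many of its elements $s$ a single formula $\varphi(c_s,x,\cdot)$ defines $s$,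
with $c_s\in K^n$; one may also assume that countable sets of such $s$ are bounded among them. Let
$D_s$ be the set of $a\in K^n$ for which $\varphi(a,x,\cdot)$ has a solution above $s$. These sets
decrease strictly, since $c_{s'}\in D_s$ iff $s<s'$. This contradicts `exists_trace_eq_of_antitone`,
by which such a family is eventually constant.

That lemma is proved by induction on $n$. Over a fixed first coordinate the fibres stabilise; let
$Z_s$ be the set of first coordinates whose fibre is not yet stable at $s$. The $Z_s$ decrease and
have empty intersection. They need not be definable, but each alternates boundedly often: the cut of
$x$ has a definable neighbourhood basis (`exists_isNeighbourhoodFormula`), so $Z_s$ is an iterated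
directed union of members of one definable family, where alternation is uniformly bounded
(`IsOMinimalTheory.exists_not_alternates`). As all subsets of $K$ have countable cofinality and
coinitiality, some $Z_s$ is empty (`exists_eq_empty_of_antitone`). -/

namespace OMin

/-! ### Linear orders: alternation, cofinality, well-ordered subsets. -/

section Order

variable {K : Type*} [LinearOrder K]

/-- There is a strictly increasing sequence of length `2 * r + 1` that alternates between `Y` and
its complement, starting and ending in `Y`. -/
def Alternates (r : ℕ) (Y : Set K) : Prop :=
  ∃ f : ℕ → K, (∀ i < 2 * r, f i < f (i + 1)) ∧ ∀ i ≤ 2 * r, (f i ∈ Y ↔ Even i)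

/-- Only finitely many points have to lie in the set, so one member of the directed family contains
them all; points outside the union are outside every member. -/
theorem Alternates.of_iUnion {ι : Type*} [Nonempty ι] {Y : ι → Set K} (hY : Directed (· ⊆ ·) Y)
    {r : ℕ} (h : Alternates r (⋃ i, Y i)) : ∃ i, Alternates r (Y i) := by
  obtain ⟨f, hf, hf'⟩ := h
  have hfin : (f '' {i | i ≤ 2 * r ∧ Even i}).Finite :=
    ((Set.finite_Iic (2 * r)).subset fun i hi => hi.1).image f
  have hsub : f '' {i | i ≤ 2 * r ∧ Even i} ⊆ ⋃ i, Y i := by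
    rintro _ ⟨i, ⟨hi, he⟩, rfl⟩
    exact (hf' i hi).2 he
  obtain ⟨k, hk⟩ : ∃ k, f '' {i | i ≤ 2 * r ∧ Even i} ⊆ Y k := by
    obtain ⟨J, hJ, hJ'⟩ := Set.finite_subset_iUnion hfin hsub
    obtain ⟨k, hk⟩ := hY.finite_set_le hJ
    exact ⟨k, hJ'.trans (Set.iUnion₂_subset hk)⟩
  exact ⟨k, f, hf, fun i hi => ⟨fun h => (hf' i hi).1 (Set.mem_iUnion_of_mem k h),
    fun h => hk ⟨i, ⟨hi, h⟩, rfl⟩⟩⟩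

/-- Every subset of `K` has a countable cofinal subset. -/
def CountablyCofinal (K : Type*) [LinearOrder K] : Prop :=
  ∀ X : Set K, ∃ C ⊆ X, C.Countable ∧ ∀ x ∈ X, ∃ c ∈ C, x ≤ c

/-- Along any well-ordering of `X`, the elements larger than all earlier ones are cofinal in `X`. On
them the two orders agree, so they form a well-ordered, hence countable, set. -/
theorem countablyCofinal_of_not_containsUncountableWellOrder
    (h : ¬ ContainsUncountableWellOrder K) : CountablyCofinal K := by
  intro X
  have hcof := isCofinal_setOfPred_imp_lt (α := X) WellOrderingRel
  set D : Set X := {a | ∀ b, WellOrderingRel b a → b < a}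
  have hwf : D.IsWF := by
    refine Subrelation.wf (r := InvImage WellOrderingRel Subtype.val) (fun {a b} hab => ?_)
      (InvImage.wf _ WellOrderingRel.isWellOrder.wf)
    rcases trichotomous_of WellOrderingRel (a : X) b with h | h | h
    · exact h
    · exact absurd h hab.ne
    · exact absurd (a.2 _ h) (lt_asymm hab)
  refine ⟨Subtype.val '' D, by simp, ?_, fun x hx => ?_⟩
  · by_contra hunc
    refine h ⟨_, ?_, hunc⟩
    rw [Set.isWF_iff_no_descending_seq] at hwf ⊢
    intro f hf hfD
    choose g hg hg' using hfD
    exact hwf g (fun a b hab => by simpa [← Subtype.coe_lt_coe, hg'] using hf hab) hg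
  · obtain ⟨c, hc, hle⟩ := hcof ⟨x, hx⟩
    exact ⟨c, ⟨c, hc, rfl⟩, hle⟩

theorem exists_nat_alternating {Y Λ : Set K} (hY : ∀ l ∈ Λ, ∃ y ∈ Y ∩ Λ, l < y)
    (hY' : ∀ l ∈ Λ, ∃ y ∈ Λ, l < y ∧ y ∉ Y) (hne : Λ.Nonempty) (r : ℕ) : Alternates r Y := by
  have step : ∀ (n : ℕ) (l : Λ), ∃ y : Λ, l < y ∧ ((y : K) ∈ Y ↔ Even n) := by
    intro n l
    by_cases hn : Even n
    · obtain ⟨y, hy, hl⟩ := hY l l.2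
      exact ⟨⟨y, hy.2⟩, hl, by simp [hn, hy.1]⟩
    · obtain ⟨y, hy, hl, hy'⟩ := hY' l l.2
      exact ⟨⟨y, hy⟩, hl, by simp [hn, hy']⟩
  choose g hg hg' using step
  obtain ⟨l₀, hl₀⟩ := hne
  let f : ℕ → Λ := fun n => Nat.rec (g 0 ⟨l₀, hl₀⟩) (fun n y => g (n + 1) y) n
  have hf : ∀ i, f i < f (i + 1) := fun i => hg (i + 1) (f i)
  refine ⟨Subtype.val ∘ f, fun i _ => hf i, fun i _ => ?_⟩
  cases i with
  | zero => exact hg' 0 _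
  | succ n => exact hg' (n + 1) (f n)

/-- An antitone family of tame subsets of `K` with empty intersection, indexed by an order of
uncountable cofinality, is eventually empty. -/
theorem exists_eq_empty_of_antitone {I : Type*} [LinearOrder I]
    (hI : ∀ C : Set I, C.Countable → BddAbove C) (hK : CountablyCofinal K)
    (hK' : CountablyCofinal Kᵒᵈ) {Z : I → Set K} (hZ : Antitone Z)
    (htame : ∀ i, ∃ r, ¬ Alternates r (Z i)) (hemp : ∀ a, ∃ i, a ∉ Z i) : ∃ i, Z i = ∅ := by
  by_contra! hne
  have : Nonempty I := ⟨(hI ∅ Set.countable_empty).some⟩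
  have hI' : ∀ {A : Type _} (C : Set A) (hC : C.Countable) (g : A → I), ∃ i, ∀ c ∈ C, g c ≤ i := by
    intro A C hC g
    obtain ⟨i, hi⟩ := hI (g '' C) (hC.image g)
    exact ⟨i, fun c hc => hi ⟨c, hc, rfl⟩⟩
  -- the lower closures of the `Z i` are eventually constant
  obtain ⟨i₀, hi₀⟩ : ∃ i₀, ∀ i, ∀ y ∈ Z i₀, ∃ z ∈ Z i, y ≤ z := by
    -- `C` is coinitial among the strict upper bounds of the various `Z i`, and `i₀` is so late that
    -- every member of `C` already bounds `Z i₀`.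
    obtain ⟨C, hCX, hC, hC'⟩ := hK' {u : K | ∃ i, ∀ z ∈ Z i, z < u}
    choose! g hg using hCX
    obtain ⟨i₀, hi₀⟩ := hI' C hC g
    refine ⟨i₀, fun i y hy => ?_⟩
    by_contra! hcon
    obtain ⟨c, hc, hle⟩ := hC' y ⟨i, hcon⟩
    exact absurd (hg hc y (hZ (hi₀ c hc) hy)) (not_lt.2 hle)
  obtain ⟨C, hCX, hC, hC'⟩ := hK (Z i₀)
  have hmax : ∀ y ∈ Z i₀, ∃ z ∈ Z i₀, y < z := by
    intro y hy
    by_contra! hcon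
    obtain ⟨i, hi⟩ := hemp y
    obtain ⟨z, hz, hyz⟩ := hi₀ (max i i₀) y hy
    have := hcon z (hZ (le_max_right _ _) hz)
    obtain rfl := le_antisymm hyz this
    exact hi (hZ (le_max_left _ _) hz)
  -- Otherwise `Z i` and its complement are both cofinal in `Z i₀`, and `Z i` alternates arbitrarily
  -- often.
  have hfinal : ∀ i ≥ i₀, ∃ c ∈ C, ∀ y ∈ Z i₀, c < y → y ∈ Z i := by
    intro i hi
    by_contra! hcon
    obtain ⟨r, hr⟩ := htame i
    refine hr (exists_nat_alternating (Λ := Z i₀) (fun l hl => ?_) (fun l hl => ?_) (hne i₀) r)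
    · obtain ⟨l', hl', hll⟩ := hmax l hl
      obtain ⟨z, hz, hlz⟩ := hi₀ i l' hl'
      exact ⟨z, ⟨hz, hZ hi hz⟩, hll.trans_le hlz⟩
    · obtain ⟨c, hc, hlc⟩ := hC' l hl
      obtain ⟨y, hy, hcy, hy'⟩ := hcon c hc
      exact ⟨y, hy, hlc.trans_lt hcy, hy'⟩
  -- Each `c` serves only a bounded set of indices; as `C` is countable, some index is served by
  -- none.
  have hbad : ∀ c ∈ C, ∃ i, ∀ i' ≥ i, ¬ ∀ y ∈ Z i₀, c < y → y ∈ Z i' := by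
    intro c hc
    obtain ⟨y, hy, hcy⟩ := hmax c (hCX hc)
    obtain ⟨i, hi⟩ := hemp y
    exact ⟨i, fun i' hi' h => hi (hZ hi' (h y hy hcy))⟩
  choose! g hg using hbad
  obtain ⟨i₁, hi₁⟩ := hI' C hC g
  obtain ⟨c, hc, h⟩ := hfinal (max i₀ i₁) (le_max_left _ _)
  exact hg c hc _ ((hi₁ c hc).trans (le_max_right _ _)) h

/-- A finite union of points and intervals has finitely many endpoints. -/
theorem exists_finite_endpoints {F : Set (Set K)} (hF : F.Finite)
    (h : ∀ I ∈ F, IsPointOrInterval I) :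
    ∃ E : Set K, E.Finite ∧ ∀ t t', t ≤ t' → (∀ e ∈ E, ¬ (t ≤ e ∧ e ≤ t')) →
      (t ∈ ⋃₀ F ↔ t' ∈ ⋃₀ F) := by
  have h1 : ∀ I ∈ F, ∃ E : Set K, E.Finite ∧ ∀ t t', t ≤ t' → (∀ e ∈ E, ¬ (t ≤ e ∧ e ≤ t')) →
      (t ∈ I ↔ t' ∈ I) := by
    intro I hI
    rcases h I hI with ⟨a, rfl⟩ | ⟨a, b, rfl⟩ | ⟨a, rfl⟩ | ⟨a, rfl⟩ | rfl
    · refine ⟨{a}, Set.finite_singleton a, fun t t' htt hE => ?_⟩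
      have := hE a rfl
      simp only [Set.mem_singleton_iff]
      constructor <;> rintro rfl <;> simp_all
    · refine ⟨{a, b}, by simp, fun t t' htt hE => ?_⟩
      have ha := hE a (by simp)
      have hb := hE b (by simp)
      simp only [Set.mem_Ioo]
      grind
    · refine ⟨{a}, by simp, fun t t' htt hE => ?_⟩
      have ha := hE a (by simp)
      simp only [Set.mem_Iio]
      grind
    · refine ⟨{a}, by simp, fun t t' htt hE => ?_⟩
      have ha := hE a (by simp)
      simp only [Set.mem_Ioi]
      grind
    · exact ⟨∅, by simp, by simp⟩
  choose! E hE hE' using h1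
  refine ⟨⋃ I ∈ F, E I, hF.biUnion hE, fun t t' htt h => ?_⟩
  simp only [Set.mem_sUnion]
  refine exists_congr fun I => and_congr_right fun hI => hE' I hI t t' htt fun e he =>
    h e (Set.mem_biUnion hI he)

theorem IsPointOrInterval.ordConnected {I : Set K} (h : IsPointOrInterval I) :
    I.OrdConnected := by
  rcases h with ⟨a, rfl⟩ | ⟨a, b, rfl⟩ | ⟨a, rfl⟩ | ⟨a, rfl⟩ | rfl
  exacts [Set.ordConnected_singleton, Set.ordConnected_Ioo, Set.ordConnected_Iio,
    Set.ordConnected_Ioi, Set.ordConnected_univ]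

/-- A finite union of convex sets admits no infinite increasing alternating sequence. -/
theorem not_alternating_sUnion {F : Set (Set K)} (hF : F.Finite)
    (h : ∀ I ∈ F, IsPointOrInterval I) {f : ℕ → K} (hf : StrictMono f)
    (hf' : ∀ i, f i ∈ ⋃₀ F ↔ Even i) : False := by
  have : ∀ i, ∃ I ∈ F, f (2 * i) ∈ I := fun i => (hf' (2 * i)).2 (even_two_mul i)
  choose g hg hg' using this
  -- Two even-indexed terms share a convex piece, which then also contains an odd-indexed term
  -- between them.
  obtain ⟨m, n, hmn, hne⟩ : ∃ m n, m < n ∧ g m = g n := by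
    have := hF.to_subtype
    obtain ⟨m, n, hmn, he⟩ := Finite.exists_ne_map_eq_of_infinite fun i => (⟨g i, hg i⟩ : F)
    simp only [Subtype.mk.injEq] at he
    rcases lt_or_gt_of_ne hmn with h | h
    exacts [⟨m, n, h, he⟩, ⟨n, m, h, he.symm⟩]
  have hmem : f (2 * m + 1) ∈ g n :=
    (h _ (hg n)).ordConnected.out (hne ▸ hg' m) (hg' n)
      ⟨hf.monotone (by omega), hf.monotone (by omega)⟩
  have := (hf' (2 * m + 1)).1 ⟨g n, hg n, hmem⟩
  exact absurd this (by simp)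

/-- An uncountable well-ordered set has an uncountable subset in which countable sets are bounded. -/
theorem exists_uncountable_bddAbove {S : Set K} (hS : S.IsWF) (hS' : ¬ S.Countable) :
    ∃ S' ⊆ S, ∀ C : Set S', C.Countable → ∃ s : S', ∀ c ∈ C, c < s := by
  have key : ∃ S' ⊆ S, ¬ S'.Countable ∧ ∀ s ∈ S', {t ∈ S' | t < s}.Countable := by
    -- The initial segment below the least such `s` is uncountable with countable proper initial
    -- segments, like $\omega_1$.
    by_cases h : ∃ s ∈ S, ¬ {t ∈ S | t < s}.Countable
    · have hwf : {s ∈ S | ¬ {t ∈ S | t < s}.Countable}.IsWF := hS.mono fun s hs => hs.1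
      obtain ⟨s, hs, hmin⟩ : ∃ s ∈ {s ∈ S | ¬ {t ∈ S | t < s}.Countable},
          ∀ t ∈ {s ∈ S | ¬ {t ∈ S | t < s}.Countable}, s ≤ t :=
        ⟨hwf.min h, hwf.min_mem h, fun t ht => hwf.min_le h ht⟩
      refine ⟨{t ∈ S | t < s}, fun t ht => ht.1, hs.2, fun t ht => ?_⟩
      by_contra hcon
      refine absurd (hmin t ⟨ht.1, fun hc => hcon (hc.mono ?_)⟩) (not_le.2 ht.2)
      exact fun u hu => ⟨hu.1.1, hu.2⟩
    · push Not at h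
      exact ⟨S, subset_rfl, hS', h⟩
  obtain ⟨S', hsub, hunc, hseg⟩ := key
  refine ⟨S', hsub, fun C hC => ?_⟩
  by_contra! hcon
  refine hunc (((hC.image Subtype.val).union
    (hC.biUnion fun c _ => hseg c c.2)).mono fun s hs => ?_)
  obtain ⟨c, hc, hle⟩ := hcon ⟨s, hs⟩
  rcases hle.eq_or_lt with h | h
  · exact Or.inl ⟨c, hc, by rw [← h]⟩
  · exact Or.inr (Set.mem_biUnion hc ⟨hs, h⟩)

end Order

/-! ### Definable subsets of the line and the uniform bound on alternation. -/

open FirstOrder.Language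

variable {L : FirstOrder.Language.{u, v}}

/-- The subset of `M` defined by `ψ` with parameters `v`. -/
def fiber {M γ : Type*} [L.Structure M] (ψ : L.Formula (γ ⊕ Unit)) (v : γ → M) : Set M :=
  {t | ψ.Realize (Sum.elim v fun _ => t)}

theorem mem_fiber {M γ : Type*} [L.Structure M] {ψ : L.Formula (γ ⊕ Unit)} {v : γ → M} {t : M} :
    t ∈ fiber ψ v ↔ ψ.Realize (Sum.elim v fun _ => t) := Iff.rfl

theorem definable₁_fiber {M γ : Type*} [L.Structure M] (ψ : L.Formula (γ ⊕ Unit)) (v : γ → M) :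
    (Set.univ : Set M).Definable₁ L (fiber ψ v) := by
  refine Set.definable_iff_exists_formula_sum.2
    ⟨ψ.relabel (Sum.map (fun i => ⟨v i, Set.mem_univ _⟩) fun _ => 0), ?_⟩
  ext f
  simp only [Set.mem_ofPred_eq, Formula.realize_relabel, mem_fiber]
  refine iff_of_eq (congrArg _ (funext fun i => ?_))
  rcases i with i | i <;> rfl

/-- The formula `a < b` in two variables. -/
def ltFormula [L.IsOrdered] {γ : Type*} (a b : γ) : L.Formula γ :=
  Term.lt (Term.var (Sum.inl a)) (Term.var (Sum.inl b))

theorem realize_ltFormula [L.IsOrdered] {M γ : Type*} [LinearOrder M] [L.Structure M]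
    [L.OrderedStructure M] (a b : γ) (v : γ → M) :
    (ltFormula (L := L) a b).Realize v ↔ v a < v b := by
  simp [ltFormula, Formula.Realize]

/-- The formula `∀ t, χ(e, t) → ψ(v, t)`. -/
noncomputable def subsetFormula {β γ : Type*} (χ : L.Formula (β ⊕ Unit))
    (ψ : L.Formula (γ ⊕ Unit)) : L.Formula (β ⊕ γ) :=
  Formula.iAlls Unit ((χ.relabel (Sum.map Sum.inl id)).imp (ψ.relabel (Sum.map Sum.inr id)))

theorem realize_subsetFormula {M β γ : Type*} [L.Structure M] {χ : L.Formula (β ⊕ Unit)}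
    {ψ : L.Formula (γ ⊕ Unit)} {w : β ⊕ γ → M} :
    (subsetFormula χ ψ).Realize w ↔ fiber χ (w ∘ Sum.inl) ⊆ fiber ψ (w ∘ Sum.inr) := by
  have h1 : ∀ i : Unit → M, Sum.elim w i ∘ Sum.map Sum.inl id =
      Sum.elim (w ∘ Sum.inl) fun _ => i () := by
    intro i; funext k; rcases k with k | k <;> rfl
  have h2 : ∀ i : Unit → M, Sum.elim w i ∘ Sum.map Sum.inr id =
      Sum.elim (w ∘ Sum.inr) fun _ => i () := by
    intro i; funext k; rcases k with k | k <;> rfl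
  simp only [subsetFormula, Formula.realize_iAlls, Formula.realize_imp, Formula.realize_relabel,
    h1, h2]
  exact ⟨fun h t ht => h (fun _ => t) ht, fun h i hi => h hi⟩

/-- An inclusion between definable subsets of `K` persists in an elementary extension. -/
theorem fiber_subset_fiber_map {K N β γ : Type*} [L.Structure K] [L.Structure N] (j : K ↪ₑ[L] N)
    {χ : L.Formula (β ⊕ Unit)} {ψ : L.Formula (γ ⊕ Unit)} {e : β → K} {v : γ → K}
    (h : fiber χ e ⊆ fiber ψ v) : fiber χ (j ∘ e) ⊆ fiber ψ (j ∘ v) := by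
  have := (j.map_formula (subsetFormula χ ψ) (Sum.elim e v)).2 (realize_subsetFormula.2 (by simpa))
  simpa [Function.comp_assoc] using realize_subsetFormula.1 this

/-- In a model of an o-minimal theory, the number of alternations is bounded in each definable
family of subsets of the line. -/
theorem IsOMinimalTheory.exists_not_alternates [L.IsOrdered] {T : L.Theory}
    (hT : IsOMinimalTheory.{u, v, w} T) (K : Type w) [LinearOrder K] [L.Structure K]
    [L.OrderedStructure K] [K ⊨ T] [Nonempty K] {γ : Type*} (ψ : L.Formula (γ ⊕ Unit)) :
    ∃ r, ∀ v : γ → K, ¬ Alternates r (fiber ψ v) := by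
  classical
  -- Counterexamples for all `r` combine, in an ultrapower of `K` that is again a model of `T`, into
  -- one definable set with an infinite increasing alternating sequence.
  by_contra! hcon
  choose v f hf hf' using hcon
  let U : Ultrafilter ℕ := Filter.hyperfilter ℕ
  let M : Type w := (U : Filter ℕ).Product fun _ => K
  have : M ⊨ T := T.model_iff.2 fun φ hφ => (Ultraproduct.sentence_realize φ).2
    (Filter.Eventually.of_forall fun _ => T.realize_sentence_of_mem hφ)
  have : M ⊨ L.linearOrderTheory :=
    (Theory.model_iff _).2 fun φ hφ => (hT.1 φ hφ).realize_sentence M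
  let : LinearOrder M := L.linearOrderOfModels M
  have : L.OrderedStructure M := inferInstance
  let V : γ → M := fun g => ((fun r => v r g : ℕ → K) : (U : Filter ℕ).Product fun _ => K)
  let F : ℕ → M := fun i => ((fun r => f r i : ℕ → K) : (U : Filter ℕ).Product fun _ => K)
  have hlarge : ∀ m : ℕ, ∀ᶠ r in (U : Filter ℕ), m ≤ r := fun m =>
    Nat.hyperfilter_le_atTop (Filter.eventually_ge_atTop m)
  have hF : StrictMono F := by
    refine strictMono_nat_of_lt_succ fun i => ?_
    have h1 := Ultraproduct.realize_formula_cast (u := U) (M := fun _ => K)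
      (ltFormula (L := L) false true) fun b r => cond b (f r (i + 1)) (f r i)
    have h2 : (fun b => ((fun r => cond b (f r (i + 1)) (f r i) : ℕ → K) :
        (U : Filter ℕ).Product fun _ => K)) = fun b => cond b (F (i + 1)) (F i) := by
      funext b; cases b <;> rfl
    rw [h2] at h1
    refine (realize_ltFormula (L := L) (M := M) false true fun b => cond b (F (i + 1)) (F i)).1 (h1.2 ?_)
    filter_upwards [hlarge (i + 1)] with r hr
    exact (realize_ltFormula _ _ _).2 (hf r i (by omega))
  have hF' : ∀ i, F i ∈ fiber ψ V ↔ Even i := by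
    intro i
    have h1 := Ultraproduct.realize_formula_cast (u := U) (M := fun _ => K) ψ
      (Sum.elim (fun g r => v r g) fun _ r => f r i)
    have h2 : (fun k : γ ⊕ Unit => ((Sum.elim (fun g r => v r g) (fun _ r => f r i) k : ℕ → K) :
        (U : Filter ℕ).Product fun _ => K)) = Sum.elim V fun _ => F i := by
      funext k; rcases k with k | k <;> rfl
    have h3 : ∀ r, (fun k : γ ⊕ Unit => Sum.elim (fun g r => v r g) (fun _ r => f r i) k r) =
        Sum.elim (v r) fun _ => f r i := by
      intro r; funext k; rcases k with k | k <;> rfl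
    simp only [h2, h3] at h1
    refine h1.trans ⟨fun h => ?_, fun h => ?_⟩
    · obtain ⟨r, hr, hr'⟩ := (h.and (hlarge i)).exists
      exact (hf' r i (by omega)).1 hr
    · filter_upwards [hlarge i] with r hr
      exact (hf' r i (by omega)).2 h
  obtain ⟨S, hS, hS', hSe⟩ := hT.2 M _ (definable₁_fiber ψ V)
  rw [hSe] at hF'
  exact not_alternating_sUnion hS hS' hF hF'

/-! ### Definable neighbourhoods of a cut. -/

open Classical in
/-- The formula `e₀ < t < e₁`, where the first inequality is present if `p` holds, and the second
if `q` holds. -/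
noncomputable def intervalFormula [L.IsOrdered] (p q : Prop) : L.Formula (Bool ⊕ Unit) :=
  (if p then ltFormula (Sum.inl false) (Sum.inr ()) else ⊤) ⊓
    (if q then ltFormula (Sum.inr ()) (Sum.inl true) else ⊤)

theorem mem_fiber_intervalFormula [L.IsOrdered] {M : Type*} [LinearOrder M] [L.Structure M]
    [L.OrderedStructure M] {p q : Prop} {e : Bool → M} {t : M} :
    t ∈ fiber (intervalFormula (L := L) p q) e ↔ (p → e false < t) ∧ (q → t < e true) := by
  simp only [mem_fiber, intervalFormula, Formula.realize_inf]
  split_ifs with h1 h2 h2 <;> simp [h1, h2, realize_ltFormula]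

/-- The sets defined by `χ` around `x` form a basis of neighbourhoods of the cut of `x` over `K`. -/
def IsNeighbourhoodFormula {K N : Type*} [L.Structure K] [L.Structure N] (j : K ↪ₑ[L] N) (x : N)
    (χ : L.Formula (Bool ⊕ Unit)) : Prop :=
  ∀ {γ : Type} (ψ : L.Formula (γ ⊕ Unit)) (v : γ → K),
    x ∈ fiber ψ (j ∘ v) → ∃ e : Bool → K, x ∈ fiber χ (j ∘ e) ∧ fiber χ e ⊆ fiber ψ v

/-- A cut of `K` realised by `x` in an elementary extension has a uniformly definable basis of
neighbourhoods. -/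
theorem exists_isNeighbourhoodFormula [L.IsOrdered] {K N : Type*} [LinearOrder K] [L.Structure K]
    [L.OrderedStructure K] [LinearOrder N] [L.Structure N] [L.OrderedStructure N]
    (hK : IsOMinimalStructure L K) (j : K ↪ₑ[L] N) [Nonempty K] {x : N} (hx : ∀ k, j k ≠ x) :
    ∃ χ : L.Formula (Bool ⊕ Unit), IsNeighbourhoodFormula j x χ := by
  classical
  have hj : StrictMono j := HomClass.strictMono (L := L) j
  have k₀ : K := Classical.arbitrary K
  let χ : L.Formula (Bool ⊕ Unit) := intervalFormula (∃ k, j k < x) (∃ k, x < j k)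
  refine ⟨χ, fun {γ} ψ v hψ => ?_⟩
  obtain ⟨F, hF, hF', hFe⟩ := hK _ (definable₁_fiber ψ v)
  obtain ⟨E, hE, hE'⟩ := exists_finite_endpoints hF hF'
  -- `d` is at least every endpoint below `x`; adjoining `k` covers the case of no such endpoint. If
  -- no point of `K` is below `x`, then `χ` has no lower constraint and `k₀` is a dummy value.
  obtain ⟨d, hd, hdE⟩ : ∃ d, ((∃ k, j k < x) → j d < x) ∧ ∀ e ∈ E, j e < x → e ≤ d := by
    by_cases h : ∃ k, j k < x
    · obtain ⟨k, hk⟩ := h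
      obtain ⟨d, ⟨hd, hdx⟩, hmax⟩ := Set.exists_max_image (insert k E ∩ {e | j e < x}) id
        ((hE.insert k).inter_of_left _) ⟨k, by simp, hk⟩
      exact ⟨d, fun _ => hdx, fun e he hex => hmax e ⟨Or.inr he, hex⟩⟩
    · exact ⟨k₀, fun h' => absurd h' h, fun e _ he => absurd ⟨e, he⟩ h⟩
  obtain ⟨d', hd', hdE'⟩ : ∃ d, ((∃ k, x < j k) → x < j d) ∧ ∀ e ∈ E, x < j e → d ≤ e := by
    by_cases h : ∃ k, x < j k
    · obtain ⟨k, hk⟩ := h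
      obtain ⟨d, ⟨hd, hdx⟩, hmax⟩ := Set.exists_min_image (insert k E ∩ {e | x < j e}) id
        ((hE.insert k).inter_of_left _) ⟨k, by simp, hk⟩
      exact ⟨d, fun _ => hdx, fun e he hex => hmax e ⟨Or.inr he, hex⟩⟩
    · exact ⟨k₀, fun h' => absurd h' h, fun e _ he => absurd ⟨e, he⟩ h⟩
  let e : Bool → K := fun b => cond b d' d
  have hxe : x ∈ fiber χ (j ∘ e) := mem_fiber_intervalFormula.2 ⟨hd, hd'⟩
  have hconst : ∀ t ∈ fiber χ e, ∀ t' ∈ fiber χ e, t ≤ t' → (t ∈ fiber ψ v ↔ t' ∈ fiber ψ v) := by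
    intro t ht t' ht' htt
    rw [hFe]
    refine hE' t t' htt fun p hp ⟨h1, h2⟩ => ?_
    rcases lt_or_gt_of_ne (hx p) with h | h
    · exact absurd (hdE p hp h) (not_le.2 (((mem_fiber_intervalFormula.1 ht).1 ⟨p, h⟩).trans_le h1))
    · exact absurd (hdE' p hp h) (not_le.2 (h2.trans_lt ((mem_fiber_intervalFormula.1 ht').2 ⟨p, h⟩)))
  refine ⟨e, hxe, fun t ht => ?_⟩
  by_contra htψ
  -- Membership in `fiber ψ v` is constant on `fiber χ e`. If it failed there, it would fail at `x`
  -- as well, by transfer to `N`.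
  have hsub : fiber χ e ⊆ fiber ψ.not v := by
    intro t' ht'
    have : t' ∉ fiber ψ v := by
      rcases le_total t t' with h | h
      · rwa [← hconst t ht t' ht' h]
      · rwa [hconst t' ht' t ht h]
    simpa [mem_fiber] using this
  have := fiber_subset_fiber_map j hsub hxe
  rw [mem_fiber, Formula.realize_not] at this
  exact this hψ

/-! ### Traces on `K` of families definable over `x`, and their projections. -/

/-- The set of tuples `a` of `K` such that `x` satisfies `ψ(c, a, ·)` in the extension `N`. -/
def trace {K N α : Type*} [L.Structure K] [L.Structure N] (j : K ↪ₑ[L] N) (x : N) {n : ℕ}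
    (ψ : L.Formula ((α ⊕ Fin n) ⊕ Unit)) (c : α → K) : Set (Fin n → K) :=
  {a | x ∈ fiber ψ (j ∘ Sum.elim c a)}

section Trace

variable {K N : Type*} [L.Structure K] [L.Structure N] {j : K ↪ₑ[L] N} {x : N}

theorem mem_trace {α : Type*} {n : ℕ} {ψ : L.Formula ((α ⊕ Fin n) ⊕ Unit)} {c : α → K}
    {a : Fin n → K} : a ∈ trace j x ψ c ↔ x ∈ fiber ψ (j ∘ Sum.elim c a) := Iff.rfl

/-- The formula `ψ`, with its first tuple variable regarded as a parameter. -/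
def headParam {α : Type*} {n : ℕ} (ψ : L.Formula ((α ⊕ Fin (n + 1)) ⊕ Unit)) :
    L.Formula (((α ⊕ Unit) ⊕ Fin n) ⊕ Unit) :=
  ψ.relabel (Sum.map (Sum.elim (Sum.inl ∘ Sum.inl) (Fin.cons (Sum.inl (Sum.inr ())) Sum.inr)) id)

theorem mem_trace_headParam {α : Type*} {n : ℕ} {ψ : L.Formula ((α ⊕ Fin (n + 1)) ⊕ Unit)}
    {c : α → K} {a : K} {b : Fin n → K} :
    b ∈ trace j x (headParam ψ) (Sum.elim c fun _ => a) ↔ Fin.cons a b ∈ trace j x ψ c := by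
  simp only [mem_trace, headParam, mem_fiber, Formula.realize_relabel]
  refine iff_of_eq (congrArg _ (funext fun k => ?_))
  rcases k with (k | k) | k
  · rfl
  · refine Fin.cases ?_ (fun k => ?_) k <;> simp
  · rfl

/-- The formula `ψ(p, a, t) ∧ ¬ ψ(q, a, t)`. -/
def diffFormula {α β : Type*} (ψ : L.Formula ((α ⊕ β) ⊕ Unit)) :
    L.Formula (((α ⊕ α) ⊕ β) ⊕ Unit) :=
  ψ.relabel (Sum.map (Sum.map Sum.inl id) id) ⊓
    (ψ.relabel (Sum.map (Sum.map Sum.inr id) id)).not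

theorem mem_trace_diffFormula {α : Type*} {n : ℕ} {ψ : L.Formula ((α ⊕ Fin n) ⊕ Unit)}
    {p q : α → K} {a : Fin n → K} :
    a ∈ trace j x (diffFormula ψ) (Sum.elim p q) ↔ a ∈ trace j x ψ p ∧ a ∉ trace j x ψ q := by
  simp only [mem_trace, diffFormula, mem_fiber, Formula.realize_inf, Formula.realize_not,
    Formula.realize_relabel]
  refine and_congr (iff_of_eq (congrArg _ (funext fun k => ?_)))
    (not_congr (iff_of_eq (congrArg _ (funext fun k => ?_))))
  all_goals rcases k with (k | k) | k <;> rfl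

/-- The formula `∃ b, ∀ t, χ(e, t) → ψ(c, (a, b), t)` in the variable `a`. -/
noncomputable def projFormula {α : Type*} {n : ℕ} (χ : L.Formula (Bool ⊕ Unit))
    (ψ : L.Formula ((α ⊕ Fin (n + 1)) ⊕ Unit)) : L.Formula ((Bool ⊕ α) ⊕ Unit) :=
  Formula.iExs (Fin n) ((subsetFormula χ ψ).relabel
    (Sum.elim (Sum.inl ∘ Sum.inl ∘ Sum.inl)
      (Sum.elim (Sum.inl ∘ Sum.inl ∘ Sum.inr) (Fin.cons (Sum.inl (Sum.inr ())) Sum.inr))))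

theorem mem_fiber_projFormula {α : Type*} {n : ℕ} {χ : L.Formula (Bool ⊕ Unit)}
    {ψ : L.Formula ((α ⊕ Fin (n + 1)) ⊕ Unit)} {e : Bool → K} {c : α → K} {a : K} :
    a ∈ fiber (projFormula χ ψ) (Sum.elim e c) ↔
      ∃ b : Fin n → K, fiber χ e ⊆ fiber ψ (Sum.elim c (Fin.cons a b : Fin (n + 1) → K)) := by
  simp only [mem_fiber, projFormula, Formula.realize_iExs, Formula.realize_relabel,
    realize_subsetFormula]
  refine exists_congr fun b => ?_
  have h : ((Sum.elim (Sum.elim (Sum.elim e c) fun _ : Unit => a) b ∘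
      Sum.elim (Sum.inl ∘ Sum.inl ∘ Sum.inl)
        (Sum.elim (Sum.inl ∘ Sum.inl ∘ Sum.inr)
          (Fin.cons (Sum.inl (Sum.inr ())) Sum.inr))) ∘ Sum.inr) =
      Sum.elim c (Fin.cons a b : Fin (n + 1) → K) := by
    funext k
    rcases k with k | k
    · rfl
    · refine Fin.cases ?_ (fun k => ?_) k <;> simp
  rw [h]
  rfl

theorem mem_fiber_inf_relabel {M γ γ' : Type*} [L.Structure M] {χ : L.Formula (γ ⊕ Unit)}
    {χ' : L.Formula (γ' ⊕ Unit)} {v : γ ⊕ γ' → M} {t : M} :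
    t ∈ fiber (χ.relabel (Sum.map Sum.inl id) ⊓ χ'.relabel (Sum.map Sum.inr id)) v ↔
      t ∈ fiber χ (v ∘ Sum.inl) ∧ t ∈ fiber χ' (v ∘ Sum.inr) := by
  simp only [mem_fiber, Formula.realize_inf, Formula.realize_relabel]
  refine and_congr (iff_of_eq (congrArg _ (funext fun k => ?_)))
    (iff_of_eq (congrArg _ (funext fun k => ?_)))
  all_goals rcases k with k | k <;> rfl

theorem IsNeighbourhoodFormula.exists_subset_inter {χ : L.Formula (Bool ⊕ Unit)}
    (hχ : IsNeighbourhoodFormula j x χ) {e e' : Bool → K} (he : x ∈ fiber χ (j ∘ e))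
    (he' : x ∈ fiber χ (j ∘ e')) :
    ∃ e'' : Bool → K, x ∈ fiber χ (j ∘ e'') ∧ fiber χ e'' ⊆ fiber χ e ∩ fiber χ e' := by
  let ψ : L.Formula ((Bool ⊕ Bool) ⊕ Unit) :=
    χ.relabel (Sum.map Sum.inl id) ⊓ χ.relabel (Sum.map Sum.inr id)
  obtain ⟨e'', h, h'⟩ := hχ ψ (Sum.elim e e') (mem_fiber_inf_relabel.2 ⟨he, he'⟩)
  exact ⟨e'', h, fun t ht => mem_fiber_inf_relabel.1 (h' ht)⟩

/-- The projection to the first coordinate of a trace is a directed union of members of a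
definable family. -/
theorem IsNeighbourhoodFormula.proj_trace_eq_iUnion {χ : L.Formula (Bool ⊕ Unit)}
    (hχ : IsNeighbourhoodFormula j x χ) {α : Type} {n : ℕ}
    (ψ : L.Formula ((α ⊕ Fin (n + 1)) ⊕ Unit)) (c : α → K) :
    {a : K | ∃ b : Fin n → K, (Fin.cons a b : Fin (n + 1) → K) ∈ trace j x ψ c} =
      ⋃ e : {e : Bool → K // x ∈ fiber χ (j ∘ e)},
        fiber (projFormula χ ψ) (Sum.elim e.1 c) := by
  ext a
  simp only [Set.mem_ofPred_eq, Set.mem_iUnion, mem_fiber_projFormula, Subtype.exists, exists_prop]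
  constructor
  · rintro ⟨b, hb⟩
    obtain ⟨e, he, he'⟩ := hχ ψ _ hb
    exact ⟨e, he, b, he'⟩
  · rintro ⟨e, he, b, hb⟩
    exact ⟨b, fiber_subset_fiber_map j hb he⟩

theorem IsNeighbourhoodFormula.directed {χ : L.Formula (Bool ⊕ Unit)}
    (hχ : IsNeighbourhoodFormula j x χ) {α : Type} {n : ℕ}
    (ψ : L.Formula ((α ⊕ Fin (n + 1)) ⊕ Unit)) (c : α → K) :
    Directed (· ⊆ ·) fun e : {e : Bool → K // x ∈ fiber χ (j ∘ e)} =>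
      fiber (projFormula χ ψ) (Sum.elim e.1 c) := by
  intro e e'
  obtain ⟨e'', h, h'⟩ := hχ.exists_subset_inter e.2 e'.2
  refine ⟨⟨e'', h⟩, fun a ha => ?_, fun a ha => ?_⟩
  all_goals
    obtain ⟨b, hb⟩ := mem_fiber_projFormula.1 ha
    refine mem_fiber_projFormula.2 ⟨b, fun t ht => hb ?_⟩
  exacts [(h' ht).1, (h' ht).2]

end Trace

/-! ### Stabilisation of decreasing families of traces. -/

/-- Antitone families of traces over a short order are eventually constant. -/
theorem exists_trace_eq_of_antitone [L.IsOrdered] {T : L.Theory}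
    (hT : IsOMinimalTheory.{u, v, w} T) (K : Type w) [LinearOrder K] [L.Structure K]
    [L.OrderedStructure K] [K ⊨ T] [Nonempty K] (hK : CountablyCofinal K)
    (hK' : CountablyCofinal Kᵒᵈ) {N : Type*} [L.Structure N] {j : K ↪ₑ[L] N} {x : N}
    {χ : L.Formula (Bool ⊕ Unit)} (hχ : IsNeighbourhoodFormula j x χ)
    {I : Type*} [LinearOrder I] (hI : ∀ C : Set I, C.Countable → BddAbove C) (n : ℕ) :
    ∀ {α : Type} (ψ : L.Formula ((α ⊕ Fin n) ⊕ Unit)) (c : I → α → K),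
      Antitone (fun i => trace j x ψ (c i)) →
      ∃ i₀, ∀ i ≥ i₀, trace j x ψ (c i) = trace j x ψ (c i₀) := by
  have hIne : Nonempty I := ⟨(hI ∅ Set.countable_empty).some⟩
  induction n with
  | zero =>
    intro α ψ c hc
    by_cases h : ∃ i, trace j x ψ (c i) = ∅
    · obtain ⟨i, hi⟩ := h
      exact ⟨i, fun k hk => by rw [hi, ← Set.subset_empty_iff, ← hi]; exact hc hk⟩
    · push Not at h
      have : ∀ i, trace j x ψ (c i) = Set.univ := fun i => Subsingleton.eq_univ_of_nonempty (h i)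
      exact ⟨Classical.arbitrary I, fun i _ => by rw [this, this]⟩
  | succ n ih =>
    intro α ψ c hc
    let D := fun i => trace j x ψ (c i)
    -- `Z i` collects the first coordinates whose fibre still shrinks after `i`; `Z' i k` those
    -- whose fibre has shrunk by stage `k`.
    let Z' : I → I → Set K := fun i k =>
      {a | ∃ b : Fin n → K, (Fin.cons a b : Fin (n + 1) → K) ∈ D i \ D k}
    let Z : I → Set K := fun i => ⋃ k, Z' i k
    have hZ : Antitone Z := fun i i' hii => Set.iUnion_mono fun k a ⟨b, hb, hb'⟩ =>
      ⟨b, hc hii hb, hb'⟩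
    have hemp : ∀ a, ∃ i, a ∉ Z i := by
      intro a
      -- The first coordinate becomes a parameter, which is why the induction allows an arbitrary
      -- parameter type `α`.
      obtain ⟨i₀, hi₀⟩ := ih (headParam ψ) (fun i => Sum.elim (c i) fun _ => a)
        (fun i k hik b hb => mem_trace_headParam.2 (hc hik (mem_trace_headParam.1 hb)))
      refine ⟨i₀, fun ha => ?_⟩
      obtain ⟨k, b, hb, hb'⟩ := Set.mem_iUnion.1 ha
      have h := hi₀ (max i₀ k) (le_max_left _ _)
      rw [Set.ext_iff] at h
      exact hb' (hc (le_max_right i₀ k)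
        (mem_trace_headParam.1 ((h b).2 (mem_trace_headParam.2 hb))))
    have hdir : ∀ i, Directed (· ⊆ ·) (Z' i) := fun i => Monotone.directed_le
      fun k k' hkk a ⟨b, hb, hb'⟩ => ⟨b, hb, fun h => hb' (hc hkk h)⟩
    have : Nonempty {e : Bool → K // x ∈ fiber χ (j ∘ e)} := by
      obtain ⟨e, he, -⟩ := hχ (γ := Empty) ⊤ (fun i => i.elim) (by simp [mem_fiber])
      exact ⟨e, he⟩
    have htame : ∀ i, ∃ r, ¬ Alternates r (Z i) := by
      intro i
      obtain ⟨r, hr⟩ := hT.exists_not_alternates K (projFormula χ (diffFormula ψ))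
      -- The bound `r` is uniform in all parameters, so it survives both directed unions, over `k`
      -- and over the neighbourhoods `e`.
      refine ⟨r, fun h => ?_⟩
      obtain ⟨k, hk⟩ := h.of_iUnion (hdir i)
      have hZ' : Z' i k = {a : K | ∃ b : Fin n → K, (Fin.cons a b : Fin (n + 1) → K) ∈
          trace j x (diffFormula ψ) (Sum.elim (c i) (c k))} := by
        ext a
        exact exists_congr fun b => mem_trace_diffFormula.symm
      rw [hZ', hχ.proj_trace_eq_iUnion] at hk
      obtain ⟨e, he⟩ := hk.of_iUnion (hχ.directed _ _)
      exact hr _ he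
    obtain ⟨i₀, hi₀⟩ := exists_eq_empty_of_antitone hI hK hK' hZ htame hemp
    refine ⟨i₀, fun i hi => (hc hi).antisymm fun a ha => ?_⟩
    by_contra hai
    have : a 0 ∈ Z i₀ := Set.mem_iUnion.2 ⟨i, Fin.tail a, by
      rw [Fin.cons_self_tail]; exact ⟨ha, hai⟩⟩
    rw [hi₀] at this
    exact this

/-! ### Order reversal, and elements of the extension as solutions of formulas. -/

theorem not_containsUncountableWellOrder_of_strictMono {A B : Type*} [LinearOrder A]
    [LinearOrder B] {g : A → B} (hg : StrictMono g) (h : ¬ ContainsUncountableWellOrder B) :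
    ¬ ContainsUncountableWellOrder A := by
  rintro ⟨S, hS, hS'⟩
  refine h ⟨g '' S, ?_, fun hc => hS'
    (Set.countable_of_injective_of_countable_image hg.injective.injOn hc)⟩
  rw [Set.isWF_iff_no_descending_seq] at hS ⊢
  intro f hf hfS
  choose k hk hk' using hfS
  refine hS k (fun a b hab => hg.lt_iff_lt.1 ?_) hk
  rw [hk', hk']
  exact hf hab

/-- Negation reverses the order of a model of a theory extending `RCF`. -/
theorem ExtendsRCF.exists_strictAnti [L.IsOrdered] {ι : FirstOrder.Language.ring →ᴸ L}
    {T : L.Theory} (hT : ExtendsRCF ι T) (K : Type*) [LinearOrder K] [L.Structure K]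
    [L.OrderedStructure K] [K ⊨ T] [Nonempty K] : ∃ g : K → K, StrictAnti g := by
  let : FirstOrder.Language.ring.Structure K := ι.reduct K
  let : FirstOrder.Language.order.Structure K := orderStructure K
  have : ι.IsExpansionOn K := LHom.isExpansionOn_reduct ι K
  have : Language.order.OrderedStructure K := ⟨fun _ => Iff.rfl⟩
  have : L.orderLHom.IsExpansionOn K := orderedStructure_iff.1 inferInstance
  have : oring.OrderedStructure K := ⟨fun _ => Iff.rfl⟩
  have hmod : ∀ φ ∈ RCF, K ⊨ φ := fun φ hφ =>
    ((ι.sumElim L.orderLHom).realize_onSentence K φ).1 ((hT φ hφ).realize_sentence K)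
  have hfield : K ⊨ Theory.field :=
    ((LHom.sumInl : FirstOrder.Language.ring →ᴸ oring).onTheory_model _).1
      ((Theory.model_iff _).2 fun φ hφ => hmod φ (Or.inl (Or.inl (Or.inl hφ))))
  let : _root_.Field K := FirstOrder.Field.fieldOfModelField K
  let : FirstOrder.Ring.CompatibleRing K := FirstOrder.Field.compatibleRingOfModelField K
  have hadd : ∀ x y z : K, x ≤ y → x + z ≤ y + z := by
    have h := hmod addLeAdd (Or.inl (Or.inr (by simp)))
    simp only [addLeAdd, Sentence.Realize, Formula.Realize, ofRing, BoundedFormula.realize_all,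
      BoundedFormula.realize_imp, Term.realize_le, LHom.realize_onTerm] at h
    simpa [Fin.snoc] using h
  refine ⟨fun x => -x, fun x y hxy => lt_of_le_of_ne ?_ fun h => hxy.ne' (neg_injective h)⟩
  have := hadd x y (-x - y) hxy.le
  rwa [show x + (-x - y) = -y by ring, show y + (-x - y) = -x by ring] at this

/-- Every element of the definable closure of `K ∪ {x}` is the unique solution of a formula
with finitely many parameters from `K`. -/
theorem exists_formula_of_mem_dcl {K N : Type*} [L.Structure K] [L.Structure N] [Nonempty K]
    {j : K ↪ₑ[L] N} {x y : N} (hy : y ∈ dcl L (Set.range j ∪ {x})) :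
    ∃ p : Σ n : ℕ, L.Formula ((Fin n ⊕ Unit) ⊕ Unit), ∃ a : Fin p.1 → K,
      ∀ t : N, p.2.Realize (Sum.elim (Sum.elim (j ∘ a) fun _ => x) fun _ => t) ↔ t = y := by
  classical
  obtain ⟨φ, hφ⟩ := Set.definable_iff_exists_formula_sum.1 hy
  let V := φ.freeVarFinset
  let E : V ≃ Fin V.card := V.equivFin
  -- Parameters equal to `x` go to the `Unit` slot, all others to their own place in the finite
  -- tuple; unused places receive an arbitrary value.
  let g : V → (Fin V.card ⊕ Unit) ⊕ Unit := fun k =>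
    Sum.elim (fun a : ↥(Set.range j ∪ {x}) => if (a : N) = x then Sum.inl (Sum.inr ()) else Sum.inl (Sum.inl (E k)))
      (fun _ => Sum.inr ()) k.1
  have hlift : ∀ k : V, ∃ b : K, ∀ a, k.1 = Sum.inl a → (a : N) ≠ x → j b = a := by
    rintro ⟨k | k, hk⟩
    · rcases k with ⟨k, ⟨b, rfl⟩ | hkx⟩
      · exact ⟨b, by rintro a h -; rw [← Sum.inl.inj h]⟩
      · exact ⟨Classical.arbitrary K, by rintro a h h'; rw [← Sum.inl.inj h] at h'; exact absurd hkx h'⟩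
    · exact ⟨Classical.arbitrary K, by simp⟩
  choose b hb using hlift
  refine ⟨⟨V.card, φ.restrictFreeVar g⟩, b ∘ E.symm, fun t => ?_⟩
  have h1 : (t = y) ↔ φ.Realize (Sum.elim (↑) fun _ : Fin 1 => t) := by
    have := Set.ext_iff.1 hφ fun _ => t
    simpa using this
  rw [h1]
  refine BoundedFormula.realize_restrictFreeVar _ ?_
  rintro ⟨k | k, hk⟩
  · by_cases h : (k : N) = x
    · simp [g, h]
    · simp [g, h, hb ⟨_, hk⟩ k rfl h]
  · simp [g]

/-- The formula `∃ y y', y < y' ∧ φ(c, x, y) ∧ φ(a, x, y')`. -/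
noncomputable def gtFormula [L.IsOrdered] {n : ℕ} (φ : L.Formula ((Fin n ⊕ Unit) ⊕ Unit)) :
    L.Formula ((Fin n ⊕ Fin n) ⊕ Unit) :=
  Formula.iExs Bool (ltFormula (Sum.inr false) (Sum.inr true) ⊓
    (φ.relabel (Sum.elim (Sum.inl ∘ Sum.map Sum.inl id) fun _ => Sum.inr false) ⊓
    φ.relabel (Sum.elim (Sum.inl ∘ Sum.map Sum.inr id) fun _ => Sum.inr true)))

theorem mem_fiber_gtFormula [L.IsOrdered] {N : Type*} [LinearOrder N] [L.Structure N]
    [L.OrderedStructure N] {n : ℕ} {φ : L.Formula ((Fin n ⊕ Unit) ⊕ Unit)}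
    {v : Fin n ⊕ Fin n → N} {x : N} :
    x ∈ fiber (gtFormula φ) v ↔ ∃ y y', y < y' ∧
      φ.Realize (Sum.elim (Sum.elim (v ∘ Sum.inl) fun _ => x) fun _ => y) ∧
      φ.Realize (Sum.elim (Sum.elim (v ∘ Sum.inr) fun _ => x) fun _ => y') := by
  have h1 : ∀ i : Bool → N, Sum.elim (Sum.elim v fun _ : Unit => x) i ∘
      Sum.elim (Sum.inl ∘ Sum.map Sum.inl id) (fun _ : Unit => Sum.inr false) =
      Sum.elim (Sum.elim (v ∘ Sum.inl) fun _ => x) fun _ => i false := by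
    intro i; funext k; rcases k with (k | k) | k <;> rfl
  have h2 : ∀ i : Bool → N, Sum.elim (Sum.elim v fun _ : Unit => x) i ∘
      Sum.elim (Sum.inl ∘ Sum.map Sum.inr id) (fun _ : Unit => Sum.inr true) =
      Sum.elim (Sum.elim (v ∘ Sum.inr) fun _ => x) fun _ => i true := by
    intro i; funext k; rcases k with (k | k) | k <;> rfl
  simp only [mem_fiber, gtFormula, Formula.realize_iExs, Formula.realize_inf, realize_ltFormula,
    Formula.realize_relabel, h1, h2, Sum.elim_inr]
  exact ⟨fun ⟨i, h⟩ => ⟨_, _, h⟩, fun ⟨y, y', h⟩ => ⟨fun b => cond b y' y, h⟩⟩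

/-! ### The contradiction in a simple extension. -/

/-- Simple extensions of short models are short. -/
theorem not_containsUncountableWellOrder_of_isDclBasis_singleton [L.IsOrdered]
    {ι : FirstOrder.Language.ring →ᴸ L} {T : L.Theory} (hL : L.card ≤ Cardinal.aleph0)
    (hRCF : ExtendsRCF ι T) (hT : IsOMinimalTheory.{u, v, w} T) (K : Type w) [LinearOrder K]
    [L.Structure K] [L.OrderedStructure K] [K ⊨ T] (hK : ¬ ContainsUncountableWellOrder K)
    {N : Type*} [LinearOrder N] [L.Structure N] [L.OrderedStructure N] (j : K ↪ₑ[L] N) (x : N)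
    (hx : IsDclBasis L (Set.range j) {x}) : ¬ ContainsUncountableWellOrder N := by
  have hne : Nonempty K := by
    have h : (Formula.iExs Unit (⊤ : L.Formula (Empty ⊕ Unit))).Realize (j ∘ Empty.elim) := by
      rw [Formula.realize_iExs]
      exact ⟨fun _ => x, by simp⟩
    obtain ⟨i, -⟩ := Formula.realize_iExs.1 ((j.map_formula _ _).1 h)
    exact ⟨i ()⟩
  have hxK : ∀ k, j k ≠ x := by
    rintro k rfl
    refine hx.1 (j k) rfl (Set.definable_iff_exists_formula_sum.2
      ⟨Term.equal (Term.var (Sum.inl ⟨j k, Or.inl ⟨k, rfl⟩⟩)) (Term.var (Sum.inr 0)), ?_⟩)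
    ext f
    simp [eq_comm]
  -- `RCF` enters only here: negation makes the reversed order short too, so subsets of `K` also
  -- have countable coinitiality.
  obtain ⟨g, hg⟩ := hRCF.exists_strictAnti K
  have hcof := countablyCofinal_of_not_containsUncountableWellOrder hK
  have hcof' := countablyCofinal_of_not_containsUncountableWellOrder
    (not_containsUncountableWellOrder_of_strictMono (g := g ∘ OrderDual.ofDual)
      (fun a b hab => hg hab) hK)
  obtain ⟨χ, hχ⟩ := exists_isNeighbourhoodFormula (hT.2 K) j hxK
  rintro ⟨S, hS, hSunc⟩
  have hdcl : ∀ y : N, y ∈ dcl L (Set.range j ∪ {x}) := fun y => by rw [hx.2]; trivial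
  choose p a ha using fun y => exists_formula_of_mem_dcl (hdcl y)
  have hcount : Countable (Σ n : ℕ, L.Formula ((Fin n ⊕ Unit) ⊕ Unit)) := by
    have : ∀ n : ℕ, Countable (L.Formula ((Fin n ⊕ Unit) ⊕ Unit)) := fun n => by
      have h : Countable (Σ m, L.BoundedFormula ((Fin n ⊕ Unit) ⊕ Unit) m) :=
        Cardinal.mk_le_aleph0_iff.1 (BoundedFormula.card_le.trans (max_le le_rfl
          (Cardinal.add_le_aleph0.2 ⟨by simp, by simpa using hL⟩)))
      exact Function.Injective.countable
        (f := fun φ => (⟨0, φ⟩ : Σ m, L.BoundedFormula ((Fin n ⊕ Unit) ⊕ Unit) m))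
        fun φ φ' h => by simpa using h
    infer_instance
  obtain ⟨⟨n, φ⟩, hq⟩ : ∃ q, ¬ {y ∈ S | p y = q}.Countable := by
    by_contra! hcon
    refine hSunc ((Set.countable_iUnion hcon).mono fun y hy => ?_)
    exact Set.mem_iUnion.2 ⟨p y, hy, rfl⟩
  obtain ⟨S', hS'S, hS'⟩ := exists_uncountable_bddAbove (hS.mono fun y hy => hy.1) hq
  have hparam : ∀ s : S', ∃ c : Fin n → K, ∀ t : N,
      φ.Realize (Sum.elim (Sum.elim (j ∘ c) fun _ => x) fun _ => t) ↔ t = s := by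
    intro s
    obtain ⟨-, hs⟩ := hS'S s.2
    have h := ha s
    generalize a s.1 = c at h
    generalize p s.1 = q at hs c h
    subst hs
    exact ⟨c, h⟩
  choose c hc using hparam
  -- This makes the traces strictly decreasing: `c s'` lies in the trace at `s` but not in the one
  -- at `s'` when `s < s'`.
  have hmem : ∀ s s' : S', c s' ∈ trace j x (gtFormula φ) (c s) ↔ s < s' := by
    intro s s'
    rw [mem_trace, mem_fiber_gtFormula]
    simp only [Sum.comp_elim, Sum.elim_comp_inl, Sum.elim_comp_inr, hc]
    exact ⟨fun ⟨y, y', h, hy, hy'⟩ => by rwa [hy, hy'] at h, fun h => ⟨s, s', h, rfl, rfl⟩⟩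
  have hanti : Antitone fun s => trace j x (gtFormula φ) (c s) := by
    intro s s' hss b hb
    rw [mem_trace, mem_fiber_gtFormula] at hb ⊢
    simp only [Sum.comp_elim, Sum.elim_comp_inl, Sum.elim_comp_inr, hc] at hb ⊢
    obtain ⟨y, y', h, rfl, h'⟩ := hb
    exact ⟨s, y', lt_of_le_of_lt hss h, rfl, h'⟩
  obtain ⟨s₀, hs₀⟩ := exists_trace_eq_of_antitone hT K hcof hcof' hχ
    (fun C hC => (hS' C hC).imp fun s hs c hc => (hs c hc).le) n (gtFormula φ) c hanti
  obtain ⟨s₁, hs₁⟩ := hS' {s₀} (Set.countable_singleton _)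
  have h01 := hs₁ s₀ rfl
  have := (hmem s₀ s₁).2 h01
  rw [← hs₀ s₁ h01.le, hmem] at this
  exact lt_irrefl _ this

end OMin

theorem mainTheorem3 {L : FirstOrder.Language.{u, v}} [L.IsOrdered] (ι : FirstOrder.Language.ring →ᴸ L) (T : L.Theory)
    (hL : L.card ≤ Cardinal.aleph0) (hRCF : OMin.ExtendsRCF ι T)
    (hT : OMin.IsOMinimalTheory.{u, v, w} T) :
    (∀ (K : Type w) [LinearOrder K] [L.Structure K] [L.OrderedStructure K] [K ⊨ T],
      ¬ OMin.ContainsUncountableWellOrder K →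
      ∀ (Kx : Type w) [LinearOrder Kx] [L.Structure Kx] [L.OrderedStructure Kx]
        (j : K ↪ₑ[L] Kx) (x : Kx), OMin.IsDclBasis L (Set.range j) {x} →
        ¬ OMin.ContainsUncountableWellOrder Kx) ∧
    OMin.PropertyC.{u, v, w} T := by
  refine ⟨fun K _ _ _ _ hK Kx _ _ _ j x hx =>
    OMin.not_containsUncountableWellOrder_of_isDclBasis_singleton hL hRCF hT K hK j x hx, ?_⟩
  rintro K _ _ _ _ hK N _ _ _ j ⟨B, hB, hcard⟩
  obtain ⟨x, rfl⟩ := Cardinal.mk_set_eq_one_iff.1 hcard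
  exact OMin.not_containsUncountableWellOrder_of_isDclBasis_singleton hL hRCF hT K hK j x hB
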